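/- Let $r\in\mathbb N$. There are a constant $C(r)>0$ and a threshold $n_*(r)$, both depending only on $r$, such that the following holds. Let $1<t_0<N_0$ be integers, put $\alpha=\log t_0/\log N_0$, assume $r>1/\alpha$, let $n_0\ge n_*(r)$ be an integer, and set $N=N_0^{2n_0}$, $t=t_0^{2n_0}$ and $[N]=\{0,1,\dots,N-1\}$. Let $P\subset[N]$ be an arithmetic progression of length $t^{1/2}=t_0^{n_0}$, and let $P_0=\{0\}$, $P_{j+1}=\bigcup_{a\in P_j}(a+N^{-(j+1)}P)$. Let $A_0=\{0\}$ and $A_{j+1}=\bigcup_{a\in A_j}(a+A_{j+1,a})$ for $j\ge0$, where the sets $A_{j+1,a}\subset N^{-(j+1)}[N]$ are arbitrary with $|A_{j+1,a}|=t$, subject to $P_j\subset A_j$ for all $j$. Let $\mu_j$ be the measure on $\mathbb R$ with density $$\frac{d\mu_j}{dx}=\sum_{a\in A_j}t^{-j}N^j\,\mathbf 1_{[a,a+N^{-j}]},$$ and let $f_\ell=\mathbf 1_{F_\ell}$, where $F_\ell=\bigcup_{a\in P_\ell}[a,a+N^{-\ell})$. Then the measures $\mu_j$ converge weakly to a probability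 measure $\mu$, and for every real $p$ with $1\le p\le 2r$ and for all sufficiently large $\ell$, $$\big\|\widehat{f_\ell\,d\mu}\big\|_{L^p(\mathbb R)}^p\ \ge\ C(r)\,\frac{N^\ell\, r^{-\ell-1}}{t^{\ell(p+1)/2}},$$ where $\widehat{f_\ell\,d\mu}(\xi)=\int e^{-2\pi i x\xi}f_\ell(x)\,d\mu(x)$ and the left-hand side is allowed to be $+\infty$. -/

import Mathlib

open MeasureTheory Filter Topology
open scoped BoundedContinuousFunction

noncomputable section

namespace CantorRestriction

open Classical in
/-- The finite sets `A 0 = {0}`, `A (j+1) = ⋃ a ∈ A j, (a + A_{j+1,a})` of left endpoints of a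
Cantor iteration in base `N`. The choice made at step `j` for the point `a ∈ A j` is recorded
by its digit set `D j a`, that is, `A_{j+1,a} = {d / N ^ (j+1) : d ∈ D j a}`. -/
def endpoints (N : ℕ) (D : ℕ → ℝ → Finset ℕ) : ℕ → Finset ℝ
  | 0 => {0}
  | j + 1 => (endpoints N D j).biUnion fun a =>
      (D j a).image fun d : ℕ => a + (d : ℝ) / (N : ℝ) ^ (j + 1)

/-- The choices `D` are admissible: every `A_{j+1,a}` with `a ∈ A j` is a subset of
`N ^ (-(j+1)) {0, …, N-1}` with exactly `t` elements. -/
def Admissible (N t : ℕ) (D : ℕ → ℝ → Finset ℕ) : Prop :=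
  ∀ j : ℕ, ∀ a ∈ endpoints N D j, D j a ⊆ Finset.range N ∧ (D j a).card = t

/-- `P` is an arithmetic progression of length `L` (with `L` distinct terms). -/
def IsArithProg (P : Finset ℕ) (L : ℕ) : Prop :=
  ∃ x d : ℕ, 0 < d ∧ P = (Finset.range L).image fun i => x + i * d

/-- The endpoints `P_j` of the structured Cantor iteration:
`P_0 = {0}`, `P_{j+1} = ⋃ a ∈ P_j, (a + N ^ (-(j+1)) P)`. -/
def structuredEndpoints (N : ℕ) (P : Finset ℕ) : ℕ → Finset ℝ :=
  endpoints N fun _ _ => P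

/-- The absolutely continuous measure `μ_j` on `ℝ` with density
`∑ a ∈ A j, t ^ (-j) * N ^ j * 1_{[a, a + N ^ (-j)]}`. -/
def approxMeasure (N t : ℕ) (D : ℕ → ℝ → Finset ℕ) (j : ℕ) : Measure ℝ :=
  volume.withDensity fun x => ∑ a ∈ endpoints N D j,
    (Set.Icc a (a + ((N : ℝ) ^ j)⁻¹)).indicator
      (fun _ => ENNReal.ofReal (((t : ℝ) ^ j)⁻¹ * (N : ℝ) ^ j)) x

/-- `μ` is a probability measure and the weak limit of the measures `μ_j`. -/
def IsWeakLimit (N t : ℕ) (D : ℕ → ℝ → Finset ℕ) (μ : Measure ℝ) : Prop :=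
  IsProbabilityMeasure μ ∧ ∀ g : ℝ →ᵇ ℝ,
    Tendsto (fun j => ∫ x, g x ∂(approxMeasure N t D j)) atTop (𝓝 (∫ x, g x ∂μ))

/-- The set `F_ℓ = ⋃ a ∈ P_ℓ, [a, a + N ^ (-ℓ))`. -/
def structuredSet (N : ℕ) (P : Finset ℕ) (l : ℕ) : Set ℝ :=
  ⋃ a ∈ structuredEndpoints N P l, Set.Ico a (a + ((N : ℝ) ^ l)⁻¹)

/-- The characteristic function `f_ℓ` of `F_ℓ`. -/
def structuredFun (N : ℕ) (P : Finset ℕ) (l : ℕ) : ℝ → ℂ :=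
  (structuredSet N P l).indicator fun _ => 1

/-- The Fourier transform of the complex measure `f dμ`:
`ξ ↦ ∫ exp (-2 π i x ξ) f(x) dμ(x)`. -/
def fourierMeas (f : ℝ → ℂ) (μ : Measure ℝ) : ℝ → ℂ :=
  Fourier.fourierIntegral Real.fourierChar μ f

end CantorRestriction

end

/-
Write `ν = f_ℓ μ`. The `r`-fold convolution power of `ν` has Fourier transform `ν̂ ^ r` and total
mass `μ(F_ℓ) ^ r`, and it lives on the `r`-fold sumset of `F_ℓ`. That sumset is covered by
`|P + ⋯ + P| ^ ℓ` intervals of length `r N ^ (-ℓ)`, and `|P + ⋯ + P| ≤ r |P|` because `P` is an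
arithmetic progression. Testing against a smooth cutoff of this cover `E` and applying
Cauchy–Schwarz and Plancherel gives `μ(F_ℓ) ^ (2r) ≤ |E| ∫ |ν̂| ^ (2r)`, and `‖ν̂‖_∞ ≤ μ(F_ℓ)` turns
this into `μ(F_ℓ) ^ p ≤ |E| ∫ |ν̂| ^ p`.

The limit `μ` is the law of the end of a uniformly random branch of the tree of cells. A branch
reaches the right endpoint of a cell only by choosing the last child forever, so almost surely it
stays in the half-open cells and each cell of generation `ℓ` contributes mass at least `t ^ (-ℓ)`.
-/

namespace CantorRestriction

section Fourier

open scoped Manifold ContDiff FourierTransform SchwartzMap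

lemma exists_schwartzMap_one_of_isCompact {V : Type*} [NormedAddCommGroup V] [NormedSpace ℝ V]
    [FiniteDimensional ℝ V] {E U : Set V} (hE : IsCompact E) (hU : IsOpen U) (hEU : E ⊆ U) :
    ∃ φ : 𝓢(V, ℂ), (∀ x ∈ E, φ x = 1) ∧ (∀ x ∉ U, φ x = 0) ∧ ∀ x, ‖φ x‖ ≤ 1 := by
  obtain ⟨K, hK, hEK, hKU⟩ := exists_compact_between hE hU hEU
  obtain ⟨f, hf1, hf0, hf⟩ := exists_contMDiffMap_one_nhds_of_subset_interior 𝓘(ℝ, V)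
    (n := (⊤ : ℕ∞)) hE.isClosed hEK
  have hsupp : HasCompactSupport fun x => (f x : ℂ) :=
    HasCompactSupport.intro hK fun x hx => by simp [hf0 x hx]
  have hsmooth : ContDiff ℝ ∞ fun x => (f x : ℂ) :=
    Complex.ofRealCLM.contDiff.comp f.contMDiff.contDiff
  refine ⟨hsupp.toSchwartzMap hsmooth, fun x hx => ?_, fun x hx => ?_, fun x => ?_⟩
  · simp [hf1.self_of_nhdsSet x hx]
  · simp [hf0 x fun hxK => hx (hKU hxK)]
  · simpa [abs_of_nonneg (hf x).1] using (hf x).2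

lemma lintegral_enorm_sq_fourier {V H : Type*} [NormedAddCommGroup V] [InnerProductSpace ℝ V]
    [FiniteDimensional ℝ V] [MeasurableSpace V] [BorelSpace V] [NormedAddCommGroup H]
    [InnerProductSpace ℂ H] [CompleteSpace H] (f : 𝓢(V, H)) :
    ∫⁻ ξ, ‖𝓕 f ξ‖ₑ ^ 2 = ∫⁻ x, ‖f x‖ₑ ^ 2 := by
  have lintegral_eq (g : 𝓢(V, H)) : ∫⁻ x, ‖g x‖ₑ ^ 2 = ENNReal.ofReal (∫ x, ‖g x‖ ^ 2) := by
    rw [ofReal_integral_eq_lintegral_ofReal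
      ((memLp_two_iff_integrable_sq_norm g.continuous.aestronglyMeasurable).1 (g.memLp 2 volume))
      (Eventually.of_forall fun x => by positivity)]
    simp only [ENNReal.ofReal_pow (norm_nonneg _), ofReal_norm]
  rw [lintegral_eq, lintegral_eq, SchwartzMap.integral_norm_sq_fourier]

lemma continuous_fourierMeas {f : ℝ → ℂ} {ν : Measure ℝ} (hf : Integrable f ν) :
    Continuous (fourierMeas f ν) :=
  VectorFourier.fourierIntegral_continuous Real.continuous_fourierChar
    (L := LinearMap.mul ℝ ℝ) continuous_mul hf

lemma enorm_fourierMeas_le (f : ℝ → ℂ) (ν : Measure ℝ) (ξ : ℝ) :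
    ‖fourierMeas f ν ξ‖ₑ ≤ ∫⁻ x, ‖f x‖ₑ ∂ν :=
  (enorm_integral_le_lintegral_enorm _).trans_eq <| lintegral_congr fun x => by
    rw [← ofReal_norm, Circle.norm_smul, ofReal_norm]

lemma integral_fourier_mul_eq {f : ℝ → ℂ} {ν : Measure ℝ} [SigmaFinite ν] (hf : Integrable f ν)
    (ψ : 𝓢(ℝ, ℂ)) : ∫ x, 𝓕 ψ x * f x ∂ν = ∫ ξ, ψ ξ * fourierMeas f ν ξ := by
  have hflip := VectorFourier.integral_fourierIntegral_smul_eq_flip (μ := volume) (ν := ν)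
    (L := LinearMap.mul ℝ ℝ) Real.continuous_fourierChar (by exact continuous_mul) ψ.integrable hf
  have hψ (x : ℝ) : VectorFourier.fourierIntegral Real.fourierChar volume (LinearMap.mul ℝ ℝ) ψ x =
      𝓕 ψ x := by
    simp [SchwartzMap.fourier_coe, Real.fourier_eq, VectorFourier.fourierIntegral, mul_comm]
  have hf' (ξ : ℝ) : VectorFourier.fourierIntegral Real.fourierChar ν (LinearMap.mul ℝ ℝ).flip
      f ξ = fourierMeas f ν ξ := by
    simp [fourierMeas, Fourier.fourierIntegral, VectorFourier.fourierIntegral, mul_comm]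
  simpa only [hψ, hf', smul_eq_mul] using hflip

lemma enorm_integral_mul_sq_le {f : ℝ → ℂ} {ν : Measure ℝ} [SigmaFinite ν] (hf : Integrable f ν)
    (φ : 𝓢(ℝ, ℂ)) :
    ‖∫ x, φ x * f x ∂ν‖ₑ ^ 2 ≤ (∫⁻ x, ‖φ x‖ₑ ^ 2) * ∫⁻ ξ, ‖fourierMeas f ν ξ‖ₑ ^ 2 := by
  obtain ⟨ψ, rfl⟩ : ∃ ψ : 𝓢(ℝ, ℂ), 𝓕 ψ = φ := ⟨𝓕⁻ φ, FourierTransform.fourier_fourierInv_eq φ⟩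
  have hcont : Continuous (fourierMeas f ν) := continuous_fourierMeas hf
  have hholder := ENNReal.lintegral_mul_le_Lp_mul_Lq volume Real.HolderConjugate.two_two
    ψ.continuous.enorm.aemeasurable hcont.enorm.aemeasurable
  have sq_sqrt (a : ENNReal) : (a ^ (1 / 2 : ℝ)) ^ 2 = a := by
    rw [← ENNReal.rpow_mul_natCast]
    norm_num
  calc ‖∫ x, 𝓕 ψ x * f x ∂ν‖ₑ ^ 2
      ≤ (∫⁻ ξ, ‖ψ ξ‖ₑ * ‖fourierMeas f ν ξ‖ₑ) ^ 2 := by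
        rw [integral_fourier_mul_eq hf]
        gcongr
        exact (enorm_integral_le_lintegral_enorm _).trans_eq
          (lintegral_congr fun ξ => enorm_mul _ _)
    _ ≤ ((∫⁻ ξ, ‖ψ ξ‖ₑ ^ (2 : ℝ)) ^ (1 / 2 : ℝ) *
          (∫⁻ ξ, ‖fourierMeas f ν ξ‖ₑ ^ (2 : ℝ)) ^ (1 / 2 : ℝ)) ^ 2 := by
        gcongr
        exact hholder
    _ = (∫⁻ ξ, ‖𝓕 ψ ξ‖ₑ ^ 2) * ∫⁻ ξ, ‖fourierMeas f ν ξ‖ₑ ^ 2 := by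
        rw [mul_pow, sq_sqrt, sq_sqrt, lintegral_enorm_sq_fourier]
        simp only [ENNReal.rpow_two]

lemma measure_univ_sq_le {ν : Measure ℝ} [IsFiniteMeasure ν] {E : Set ℝ} (hE : IsCompact E)
    (hE0 : volume E ≠ 0) (hν : ∀ᵐ x ∂ν, x ∈ E) :
    ν Set.univ ^ 2 ≤ volume E * ∫⁻ ξ, ‖fourierMeas 1 ν ξ‖ₑ ^ 2 := by
  have le_of_lt (c : ENNReal) (hc : volume E < c) :
      ν Set.univ ^ 2 ≤ c * ∫⁻ ξ, ‖fourierMeas 1 ν ξ‖ₑ ^ 2 := by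
    obtain ⟨U, hEU, hU, hUc⟩ := E.exists_isOpen_lt_of_lt c hc
    obtain ⟨φ, hφ1, hφ0, hφ⟩ := exists_schwartzMap_one_of_isCompact hE hU hEU
    have hmass : ∫ x, φ x * (1 : ℝ → ℂ) x ∂ν = ν.real Set.univ := by
      rw [integral_congr_ae (g := fun _ => 1) (hν.mono fun x hx => by simp [hφ1 x hx])]
      simp
    have hφU : ∫⁻ x, ‖φ x‖ₑ ^ 2 ≤ volume U := by
      rw [← lintegral_indicator_one hU.measurableSet]
      refine lintegral_mono fun x => ?_
      by_cases hx : x ∈ U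
      · have hφx : ‖φ x‖ₑ ≤ 1 := by
          rw [← ofReal_norm]
          exact ENNReal.ofReal_le_one.2 (hφ x)
        simpa [hx] using pow_le_one' hφx 2
      · simp [hx, hφ0 x hx]
    calc ν Set.univ ^ 2 = ‖∫ x, φ x * (1 : ℝ → ℂ) x ∂ν‖ₑ ^ 2 := by
          rw [hmass, ← ofReal_norm, Complex.norm_real, Real.norm_of_nonneg measureReal_nonneg,
            ofReal_measureReal]
      _ ≤ (∫⁻ x, ‖φ x‖ₑ ^ 2) * ∫⁻ ξ, ‖fourierMeas 1 ν ξ‖ₑ ^ 2 :=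
          enorm_integral_mul_sq_le (integrable_const 1) φ
      _ ≤ c * ∫⁻ ξ, ‖fourierMeas 1 ν ξ‖ₑ ^ 2 := by gcongr; exact hφU.trans hUc.le
  have : (𝓝[>] volume E).NeBot := nhdsGT_neBot_of_exists_gt ⟨⊤, hE.measure_lt_top⟩
  exact ge_of_tendsto (x := 𝓝[>] volume E)
    (ENNReal.Tendsto.mul_const (tendsto_id.mono_left nhdsWithin_le_nhds) (Or.inl hE0))
    (eventually_mem_nhdsWithin.mono le_of_lt)

lemma lintegral_enorm_fourierMeas_pow_le {f : ℝ → ℂ} {ν : Measure ℝ} (hf : Integrable f ν) {n : ℕ}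
    {p : ℝ} (hp0 : 0 ≤ p) (hpn : p ≤ n) :
    ∫⁻ ξ, ‖fourierMeas f ν ξ‖ₑ ^ n ≤
      (∫⁻ x, ‖f x‖ₑ ∂ν) ^ (n - p) * ∫⁻ ξ, ‖fourierMeas f ν ξ‖ₑ ^ p := by
  have hnp : 0 ≤ n - p := sub_nonneg.2 hpn
  rw [← lintegral_const_mul' _ _ (ENNReal.rpow_ne_top_of_nonneg hnp hf.2.ne)]
  refine lintegral_mono fun ξ => ?_
  calc ‖fourierMeas f ν ξ‖ₑ ^ n = ‖fourierMeas f ν ξ‖ₑ ^ (n - p) * ‖fourierMeas f ν ξ‖ₑ ^ p := by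
        rw [← ENNReal.rpow_add_of_nonneg _ _ hnp hp0, sub_add_cancel, ENNReal.rpow_natCast]
    _ ≤ (∫⁻ x, ‖f x‖ₑ ∂ν) ^ (n - p) * ‖fourierMeas f ν ξ‖ₑ ^ p := by
        gcongr
        exact enorm_fourierMeas_le f ν ξ

end Fourier

section ConvPow

/-- The `r`-fold convolution power `ν ∗ ⋯ ∗ ν` of a measure on `ℝ`, as the image of the product
measure under the sum of the coordinates; its Fourier transform is the `r`-th power of that
of `ν`. -/
noncomputable def convPow (ν : Measure ℝ) (r : ℕ) : Measure ℝ :=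
  (Measure.pi fun _ : Fin r => ν).map fun x => ∑ i, x i

variable (ν : Measure ℝ) [IsFiniteMeasure ν] (r : ℕ)

instance : IsFiniteMeasure (convPow ν r) := by
  rw [convPow]
  infer_instance

lemma convPow_univ : convPow ν r Set.univ = ν Set.univ ^ r := by
  rw [convPow, Measure.map_apply (by fun_prop) MeasurableSet.univ, Set.preimage_univ,
    Measure.pi_univ]
  simp

variable {ν r} in
lemma ae_mem_convPow {F E : Set ℝ} (hE : MeasurableSet E) (hν : ∀ᵐ x ∂ν, x ∈ F)
    (hsum : ∀ x : Fin r → ℝ, (∀ i, x i ∈ F) → ∑ i, x i ∈ E) : ∀ᵐ y ∂convPow ν r, y ∈ E := by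
  refine (ae_map_iff (p := (· ∈ E)) (by fun_prop) hE).2 ?_
  have hpi : ∀ᵐ x ∂(Measure.pi fun _ : Fin r => ν), ∀ i, x i ∈ F :=
    ae_all_iff.2 fun i => Measure.tendsto_eval_ae_ae.eventually hν
  exact hpi.mono hsum

lemma fourierMeas_convPow (ξ : ℝ) : fourierMeas 1 (convPow ν r) ξ = fourierMeas 1 ν ξ ^ r := by
  have hchar (x : Fin r → ℝ) : Real.fourierChar (-((∑ i, x i) * ξ)) • (1 : ℂ) =
      ∏ i, Real.fourierChar (-(x i * ξ)) • (1 : ℂ) := by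
    simp only [Circle.smul_def, smul_eq_mul, mul_one, Real.fourierChar_apply, ← Complex.exp_sum]
    push_cast
    rw [Finset.sum_mul, ← Finset.sum_neg_distrib, Finset.mul_sum, Finset.sum_mul]
  have hcont : Continuous fun y : ℝ => Real.fourierChar (-(y * ξ)) • (1 : ℂ) := by
    have := Real.continuous_fourierChar
    fun_prop
  calc fourierMeas 1 (convPow ν r) ξ
      = ∫ x : Fin r → ℝ, Real.fourierChar (-((∑ i, x i) * ξ)) • (1 : ℂ) ∂Measure.pi fun _ => ν :=
        integral_map (by fun_prop) hcont.aestronglyMeasurable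
    _ = fourierMeas 1 ν ξ ^ r := by
        simp only [hchar]
        rw [integral_fintype_prod_eq_pow fun y : ℝ => Real.fourierChar (-(y * ξ)) • (1 : ℂ),
          Fintype.card_fin]
        rfl

variable {ν r} in
lemma measure_univ_pow_le {F E : Set ℝ} (hE : IsCompact E) (hE0 : volume E ≠ 0)
    (hν : ∀ᵐ x ∂ν, x ∈ F) (hsum : ∀ x : Fin r → ℝ, (∀ i, x i ∈ F) → ∑ i, x i ∈ E) :
    ν Set.univ ^ (2 * r) ≤ volume E * ∫⁻ ξ, ‖fourierMeas 1 ν ξ‖ₑ ^ (2 * r) := by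
  have h := measure_univ_sq_le hE hE0 (ae_mem_convPow hE.measurableSet hν hsum)
  simpa only [convPow_univ, fourierMeas_convPow, enorm_pow, ← pow_mul, mul_comm r] using h

end ConvPow

variable {N t : ℕ} {D : ℕ → ℝ → Finset ℕ}

section Endpoints

lemma mem_endpoints_succ {j : ℕ} {x : ℝ} :
    x ∈ endpoints N D (j + 1) ↔
      ∃ a ∈ endpoints N D j, ∃ d ∈ D j a, a + (d : ℝ) / (N : ℝ) ^ (j + 1) = x := by
  simp [endpoints]

lemma exists_nat_of_mem_endpoints (hN : 0 < N) {j : ℕ} {a : ℝ} (ha : a ∈ endpoints N D j) :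
    ∃ k : ℕ, a * (N : ℝ) ^ j = k := by
  induction j generalizing a with
  | zero => exact ⟨0, by simpa [endpoints] using ha⟩
  | succ j ih =>
    obtain ⟨b, hb, d, -, rfl⟩ := mem_endpoints_succ.1 ha
    obtain ⟨k, hk⟩ := ih hb
    refine ⟨k * N + d, ?_⟩
    push_cast
    rw [← hk]
    field_simp
    ring

lemma eq_and_eq_of_add_div_eq (hN : 0 < N) {j : ℕ} {a b : ℝ} (ha : a ∈ endpoints N D j)
    (hb : b ∈ endpoints N D j) {d e : ℕ} (hd : d < N) (he : e < N)
    (h : a + (d : ℝ) / (N : ℝ) ^ (j + 1) = b + (e : ℝ) / (N : ℝ) ^ (j + 1)) : a = b ∧ d = e := by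
  obtain ⟨k, hk⟩ := exists_nat_of_mem_endpoints hN ha
  obtain ⟨m, hm⟩ := exists_nat_of_mem_endpoints hN hb
  have hNj : (N : ℝ) ^ j ≠ 0 := by positivity
  have hkm : d + N * k = e + N * m := by
    have : ((d + N * k : ℕ) : ℝ) = (e + N * m : ℕ) := by
      push_cast
      rw [← hk, ← hm]
      field_simp at h
      linear_combination h
    exact_mod_cast this
  have hde : d = e := by
    simpa [Nat.mod_eq_of_lt hd, Nat.mod_eq_of_lt he] using congrArg (· % N) hkm
  have hk_eq : k = m := by simpa [hde, hN.ne'] using hkm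
  exact ⟨mul_right_cancel₀ hNj (by rw [hk, hm, hk_eq]), hde⟩

lemma card_endpoints (hN : 0 < N) (hD : Admissible N t D) (j : ℕ) :
    (endpoints N D j).card = t ^ j := by
  induction j with
  | zero => simp [endpoints]
  | succ j ih =>
    have digit_lt {a : ℝ} (ha : a ∈ endpoints N D j) {d : ℕ} (hd : d ∈ D j a) : d < N :=
      Finset.mem_range.1 ((hD j a ha).1 hd)
    rw [endpoints, Finset.card_biUnion]
    · rw [pow_succ t, ← ih, ← smul_eq_mul, ← Finset.sum_const]
      refine Finset.sum_congr rfl fun a ha => ?_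
      rw [Finset.card_image_of_injOn, (hD j a ha).2]
      exact fun d hd e he h =>
        (eq_and_eq_of_add_div_eq hN ha ha (digit_lt ha hd) (digit_lt ha he) h).2
    · refine fun a ha b hb hab => Finset.disjoint_left.2 fun x hx hx' => hab ?_
      obtain ⟨d, hd, rfl⟩ := Finset.mem_image.1 hx
      obtain ⟨e, he, h⟩ := Finset.mem_image.1 hx'
      exact (eq_and_eq_of_add_div_eq hN ha hb (digit_lt ha hd) (digit_lt hb he) h.symm).1

lemma card_structuredEndpoints {P : Finset ℕ} (hN : 0 < N) (hP : P ⊆ Finset.range N) (l : ℕ) :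
    (structuredEndpoints N P l).card = P.card ^ l :=
  card_endpoints hN (fun _ _ _ => ⟨hP, rfl⟩) l

lemma card_structuredEndpoints_le (P : Finset ℕ) (l : ℕ) :
    (structuredEndpoints N P l).card ≤ P.card ^ l := by
  induction l with
  | zero => simp [structuredEndpoints, endpoints]
  | succ l ih =>
    rw [pow_succ]
    exact (Finset.card_biUnion_le_card_mul _ _ _ fun _ _ => Finset.card_image_le).trans
      (Nat.mul_le_mul_right _ ih)

lemma structuredEndpoints_nonempty {P : Finset ℕ} (hP : P.Nonempty) (l : ℕ) :
    (structuredEndpoints N P l).Nonempty := by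
  induction l with
  | zero => exact Finset.singleton_nonempty 0
  | succ l ih => exact ih.biUnion fun _ _ => hP.image _

end Endpoints

section Sumset

/-- The `r`-fold sumset `P + ⋯ + P`. -/
def sumset (r : ℕ) (P : Finset ℕ) : Finset ℕ :=
  (Fintype.piFinset fun _ : Fin r => P).image fun d => ∑ i, d i

lemma mem_sumset {r : ℕ} {P : Finset ℕ} {n : ℕ} :
    n ∈ sumset r P ↔ ∃ d : Fin r → ℕ, (∀ i, d i ∈ P) ∧ ∑ i, d i = n := by
  simp [sumset]

lemma sumset_nonempty {r : ℕ} {P : Finset ℕ} (hP : P.Nonempty) : (sumset r P).Nonempty :=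
  (Fintype.piFinset_nonempty.2 fun _ => hP).image _

lemma sum_mem_structuredEndpoints {P : Finset ℕ} {r l : ℕ} {a : Fin r → ℝ}
    (ha : ∀ i, a i ∈ structuredEndpoints N P l) :
    ∑ i, a i ∈ structuredEndpoints N (sumset r P) l := by
  induction l generalizing a with
  | zero =>
    have ha0 : ∀ i, a i = 0 := by simpa [structuredEndpoints, endpoints] using ha
    simp [structuredEndpoints, endpoints, ha0]
  | succ l ih =>
    choose b hb d hd h using fun i => mem_endpoints_succ.1 (ha i)
    refine mem_endpoints_succ.2 ⟨∑ i, b i, ih hb, ∑ i, d i, mem_sumset.2 ⟨d, hd, rfl⟩, ?_⟩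
    simp only [← h, Finset.sum_add_distrib, Nat.cast_sum, Finset.sum_div]

variable {P : Finset ℕ} {L : ℕ}

lemma IsArithProg.card_eq (hP : IsArithProg P L) : P.card = L := by
  obtain ⟨x, s, hs, rfl⟩ := hP
  rw [Finset.card_image_of_injective _ fun i j h => by simpa [hs.ne'] using h, Finset.card_range]

lemma IsArithProg.card_sumset_le (hP : IsArithProg P L) {r : ℕ} (hr : 0 < r) :
    (sumset r P).card ≤ r * L := by
  obtain ⟨x, s, -, rfl⟩ := hP
  have hsub : sumset r ((Finset.range L).image fun i => x + i * s) ⊆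
      (Finset.range (r * L)).image fun i => r * x + i * s := by
    intro n hn
    obtain ⟨d, hd, rfl⟩ := mem_sumset.1 hn
    choose k hk h using fun i => Finset.mem_image.1 (hd i)
    have : Nonempty (Fin r) := ⟨⟨0, hr⟩⟩
    have hklt : ∑ i, k i < r * L := by
      simpa using Finset.sum_lt_sum_of_nonempty Finset.univ_nonempty
        fun i _ => Finset.mem_range.1 (hk i)
    refine Finset.mem_image.2 ⟨∑ i, k i, Finset.mem_range.2 hklt, ?_⟩
    simp [← h, Finset.sum_add_distrib, Finset.sum_mul]
  exact (Finset.card_le_card hsub).trans (Finset.card_image_le.trans_eq (Finset.card_range _))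

end Sumset

section Cells

/-- The union of the closed intervals of length `w` whose left endpoints are the points of `T`. -/
def cells (T : Finset ℝ) (w : ℝ) : Set ℝ :=
  ⋃ s ∈ T, Set.Icc s (s + w)

lemma isCompact_cells (T : Finset ℝ) (w : ℝ) : IsCompact (cells T w) :=
  T.isCompact_biUnion fun _ _ => isCompact_Icc

lemma volume_cells_le (T : Finset ℝ) (w : ℝ) : volume (cells T w) ≤ T.card * ENNReal.ofReal w :=
  (measure_biUnion_finset_le T _).trans_eq (by simp)

lemma volume_cells_ne_zero {T : Finset ℝ} (hT : T.Nonempty) {w : ℝ} (hw : 0 < w) :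
    volume (cells T w) ≠ 0 := by
  obtain ⟨s, hs⟩ := hT
  have hsub : Set.Icc s (s + w) ⊆ cells T w := fun x hx => Set.mem_biUnion hs hx
  have hpos : 0 < volume (Set.Icc s (s + w)) := by simpa using hw
  exact (hpos.trans_le (measure_mono hsub)).ne'

lemma sum_mem_cells {P : Finset ℕ} {r l : ℕ} {x : Fin r → ℝ}
    (hx : ∀ i, x i ∈ structuredSet N P l) :
    ∑ i, x i ∈ cells (structuredEndpoints N (sumset r P) l) (r * ((N : ℝ) ^ l)⁻¹) := by
  simp only [structuredSet, Set.mem_iUnion₂, Set.mem_Ico] at hx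
  choose a ha hax hxa using hx
  refine Set.mem_biUnion (sum_mem_structuredEndpoints ha)
    ⟨Finset.sum_le_sum fun i _ => hax i, ?_⟩
  calc ∑ i, x i ≤ ∑ i, (a i + ((N : ℝ) ^ l)⁻¹) := Finset.sum_le_sum fun i _ => (hxa i).le
    _ = ∑ i, a i + r * ((N : ℝ) ^ l)⁻¹ := by simp [Finset.sum_add_distrib]

end Cells

section Nth

variable {s : Finset ℕ}

lemma nth_mem_of_lt_card {i : ℕ} (hi : i < s.card) : Nat.nth (· ∈ s) i ∈ s :=
  Nat.nth_mem_of_lt_card s.finite_toSet (by simpa using hi)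

lemma nth_lt_nth_of_lt_card {i k : ℕ} (hik : i < k) (hk : k < s.card) :
    Nat.nth (· ∈ s) i < Nat.nth (· ∈ s) k :=
  Nat.nth_lt_nth_of_lt_card s.finite_toSet hik (by simpa using hk)

lemma exists_lt_card_nth_eq_of_mem {d : ℕ} (hd : d ∈ s) :
    ∃ i < s.card, Nat.nth (· ∈ s) i = d := by
  simpa using Nat.exists_lt_card_finite_nth_eq s.finite_toSet hd

lemma nth_inj_of_lt_card {i k : ℕ} (hi : i < s.card) (hk : k < s.card) :
    Nat.nth (· ∈ s) i = Nat.nth (· ∈ s) k ↔ i = k :=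
  (Nat.nth_injOn s.finite_toSet).eq_iff (by simpa using hi) (by simpa using hk)

end Nth

section Path

/-- The endpoints visited by the branch `ω` of the tree of cells: below an endpoint `a` of
generation `j`, the branch moves to the cell of the `ω j`-th digit of `D j a` in increasing
order. -/
noncomputable def path (N : ℕ) (D : ℕ → ℝ → Finset ℕ) (ω : ℕ → Fin t) : ℕ → ℝ
  | 0 => 0
  | j + 1 => path N D ω j + (Nat.nth (· ∈ D j (path N D ω j)) (ω j) : ℝ) / (N : ℝ) ^ (j + 1)

/-- The point of the Cantor set at the end of the branch `ω`. -/
noncomputable def pathLimit (N : ℕ) (D : ℕ → ℝ → Finset ℕ) (ω : ℕ → Fin t) : ℝ :=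
  ⨆ j, path N D ω j

lemma path_congr {ω ω' : ℕ → Fin t} {j : ℕ} (h : ∀ i < j, ω i = ω' i) :
    path N D ω j = path N D ω' j := by
  induction j with
  | zero => rfl
  | succ j ih => rw [path, path, ih fun i hi => h i (hi.trans j.lt_succ_self), h j j.lt_succ_self]

lemma measurable_path [NeZero t] (j : ℕ) : Measurable fun ω : ℕ → Fin t => path N D ω j := by
  have hfactor : (fun ω : ℕ → Fin t => path N D ω j) =
      (fun w : Fin j → Fin t => path N D (fun i => if h : i < j then w ⟨i, h⟩ else 0) j) ∘
        fun ω i => ω i := by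
    ext ω
    exact path_congr fun i hi => by simp [hi]
  rw [hfactor]
  exact (measurable_of_finite _).comp (by fun_prop)

lemma monotone_path (ω : ℕ → Fin t) : Monotone (path N D ω) :=
  monotone_nat_of_le_succ fun j => by rw [path]; exact le_add_of_nonneg_right (by positivity)

lemma path_succ_add_inv (ω : ℕ → Fin t) (j : ℕ) :
    path N D ω (j + 1) + ((N : ℝ) ^ (j + 1))⁻¹ =
      path N D ω j + (Nat.nth (· ∈ D j (path N D ω j)) (ω j) + 1) / (N : ℝ) ^ (j + 1) := by
  rw [path, add_div, one_div, add_assoc]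

lemma inv_pow_eq_div_pow_succ (hN : 0 < N) (j : ℕ) :
    ((N : ℝ) ^ j)⁻¹ = N / (N : ℝ) ^ (j + 1) := by
  field_simp
  ring

lemma path_mem (hD : Admissible N t D) (ω : ℕ → Fin t) (j : ℕ) :
    path N D ω j ∈ endpoints N D j := by
  induction j with
  | zero => simp [path, endpoints]
  | succ j ih =>
    have hcard : (D j (path N D ω j)).card = t := (hD j _ ih).2
    exact mem_endpoints_succ.2 ⟨_, ih, _, nth_mem_of_lt_card (by simp [hcard]), rfl⟩

lemma exists_path_eq [NeZero t] (hD : Admissible N t D) {j : ℕ} {a : ℝ}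
    (ha : a ∈ endpoints N D j) : ∃ ω : ℕ → Fin t, path N D ω j = a := by
  induction j generalizing a with
  | zero => exact ⟨fun _ => 0, by simpa [endpoints, path, eq_comm] using ha⟩
  | succ j ih =>
    obtain ⟨b, hb, d, hd, rfl⟩ := mem_endpoints_succ.1 ha
    obtain ⟨ω, rfl⟩ := ih hb
    obtain ⟨i, hi, rfl⟩ := exists_lt_card_nth_eq_of_mem hd
    rw [(hD j _ hb).2] at hi
    refine ⟨Function.update ω j ⟨i, hi⟩, ?_⟩
    have hpath : path N D (Function.update ω j ⟨i, hi⟩) j = path N D ω j :=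
      path_congr fun k hk => Function.update_of_ne hk.ne _ _
    rw [path, hpath, Function.update_self]

variable (hN : 0 < N) (hD : Admissible N t D)
include hD

lemma nth_lt (ω : ℕ → Fin t) (j : ℕ) (i : Fin t) :
    Nat.nth (· ∈ D j (path N D ω j)) i < N := by
  obtain ⟨hsub, hcard⟩ := hD j _ (path_mem hD ω j)
  exact Finset.mem_range.1 (hsub (nth_mem_of_lt_card (i.2.trans_eq hcard.symm)))

include hN

lemma path_eq_iff {ω ω' : ℕ → Fin t} {j : ℕ} :
    path N D ω j = path N D ω' j ↔ ∀ i < j, ω i = ω' i := by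
  refine ⟨fun h => ?_, path_congr⟩
  induction j with
  | zero => simp
  | succ j ih =>
    obtain ⟨hpath, hnth⟩ := eq_and_eq_of_add_div_eq hN (path_mem hD ω j) (path_mem hD ω' j)
      (nth_lt hD ω j _) (nth_lt hD ω' j _) h
    have hcard : (D j (path N D ω' j)).card = t := (hD j _ (path_mem hD ω' j)).2
    rw [hpath, nth_inj_of_lt_card (by simp [hcard]) (by simp [hcard]), Fin.val_inj] at hnth
    exact Nat.forall_lt_succ_right.2 ⟨ih hpath, hnth⟩

lemma antitone_path_add_inv (ω : ℕ → Fin t) : Antitone fun j => path N D ω j + ((N : ℝ) ^ j)⁻¹ :=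
  antitone_nat_of_succ_le fun j => by
    have hdigit : (Nat.nth (· ∈ D j (path N D ω j)) (ω j) : ℝ) + 1 ≤ N :=
      mod_cast nth_lt hD ω j (ω j)
    rw [path_succ_add_inv, inv_pow_eq_div_pow_succ hN]
    gcongr

lemma path_succ_add_inv_lt {ω : ℕ → Fin t} {j : ℕ} {i : Fin t} (hi : ω j < i) :
    path N D ω (j + 1) + ((N : ℝ) ^ (j + 1))⁻¹ < path N D ω j + ((N : ℝ) ^ j)⁻¹ := by
  have hcard : (D j (path N D ω j)).card = t := (hD j _ (path_mem hD ω j)).2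
  have hdigit : (Nat.nth (· ∈ D j (path N D ω j)) (ω j) : ℝ) + 1 < N :=
    mod_cast (Nat.succ_le_of_lt (nth_lt_nth_of_lt_card hi (by simp [hcard]))).trans_lt
      (nth_lt hD ω j i)
  rw [path_succ_add_inv, inv_pow_eq_div_pow_succ hN]
  gcongr

lemma path_le_path_add_inv (ω : ℕ → Fin t) (j k : ℕ) :
    path N D ω k ≤ path N D ω j + ((N : ℝ) ^ j)⁻¹ :=
  calc path N D ω k ≤ path N D ω (max j k) := monotone_path ω (le_max_right j k)
    _ ≤ path N D ω (max j k) + ((N : ℝ) ^ max j k)⁻¹ := le_add_of_nonneg_right (by positivity)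
    _ ≤ path N D ω j + ((N : ℝ) ^ j)⁻¹ := antitone_path_add_inv hN hD ω (le_max_left j k)

lemma bddAbove_range_path (ω : ℕ → Fin t) : BddAbove (Set.range (path N D ω)) :=
  ⟨_, Set.forall_mem_range.2 (path_le_path_add_inv hN hD ω 0)⟩

lemma tendsto_path (ω : ℕ → Fin t) : Tendsto (path N D ω) atTop (𝓝 (pathLimit N D ω)) :=
  tendsto_atTop_ciSup (monotone_path ω) (bddAbove_range_path hN hD ω)

lemma path_le_pathLimit (ω : ℕ → Fin t) (j : ℕ) : path N D ω j ≤ pathLimit N D ω :=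
  le_ciSup (bddAbove_range_path hN hD ω) j

lemma pathLimit_le (ω : ℕ → Fin t) (j : ℕ) :
    pathLimit N D ω ≤ path N D ω j + ((N : ℝ) ^ j)⁻¹ :=
  have : Nonempty ℕ := ⟨0⟩
  ciSup_le (path_le_path_add_inv hN hD ω j)

lemma forall_le_of_pathLimit_eq {ω : ℕ → Fin t} {j : ℕ}
    (h : pathLimit N D ω = path N D ω j + ((N : ℝ) ^ j)⁻¹) {k : ℕ} (hk : j ≤ k) (i : Fin t) :
    i ≤ ω k := by
  by_contra! hi
  exact lt_irrefl (pathLimit N D ω) <|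
    calc pathLimit N D ω ≤ path N D ω (k + 1) + ((N : ℝ) ^ (k + 1))⁻¹ := pathLimit_le hN hD ω _
      _ < path N D ω k + ((N : ℝ) ^ k)⁻¹ := path_succ_add_inv_lt hN hD hi
      _ ≤ path N D ω j + ((N : ℝ) ^ j)⁻¹ := antitone_path_add_inv hN hD ω hk
      _ = pathLimit N D ω := h.symm

lemma measurable_pathLimit [NeZero t] : Measurable fun ω : ℕ → Fin t => pathLimit N D ω :=
  measurable_of_tendsto_metrizable measurable_path
    (tendsto_pi_nhds.2 fun ω => tendsto_path hN hD ω)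

end Path

section BranchMeasure

variable [NeZero t]

/-- The law of a uniformly random branch: a sequence of independent uniform elements
of `Fin t`. -/
noncomputable def branchMeasure (t : ℕ) [NeZero t] : Measure (ℕ → Fin t) :=
  Measure.infinitePi fun _ => (PMF.uniformOfFintype (Fin t)).toMeasure

instance : IsProbabilityMeasure (branchMeasure t) := by
  rw [branchMeasure]
  infer_instance

lemma branchMeasure_cylinder (s : Finset ℕ) (w : ℕ → Fin t) :
    branchMeasure t {ω | ∀ i ∈ s, ω i = w i} = (t : ENNReal)⁻¹ ^ s.card := by
  have hpi : {ω : ℕ → Fin t | ∀ i ∈ s, ω i = w i} = Set.pi s fun i => {w i} := by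
    ext ω
    simp
  rw [hpi, branchMeasure, Measure.infinitePi_pi _ fun i _ => measurableSet_singleton _]
  simp

lemma branchMeasure_eventually_eq (ht : 1 < t) (j : ℕ) (w : ℕ → Fin t) :
    branchMeasure t {ω | ∀ k, j ≤ k → ω k = w k} = 0 := by
  have hle (n : ℕ) : branchMeasure t {ω | ∀ k, j ≤ k → ω k = w k} ≤ (t : ENNReal)⁻¹ ^ n :=
    calc branchMeasure t {ω | ∀ k, j ≤ k → ω k = w k}
        ≤ branchMeasure t {ω | ∀ i ∈ Finset.Ico j (j + n), ω i = w i} :=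
          measure_mono fun ω hω i hi => hω i (Finset.mem_Ico.1 hi).1
      _ = (t : ENNReal)⁻¹ ^ n := by rw [branchMeasure_cylinder, Nat.card_Ico, add_tsub_cancel_left]
  have ht_inv : (t : ENNReal)⁻¹ < 1 := ENNReal.inv_lt_one.2 (by exact_mod_cast ht)
  exact le_antisymm (ge_of_tendsto' (ENNReal.tendsto_pow_atTop_nhds_zero_of_lt_one ht_inv) hle)
    zero_le

end BranchMeasure

section LimitMeasure

lemma approxMeasure_eq_sum (j : ℕ) :
    approxMeasure N t D j = ∑ a ∈ endpoints N D j,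
      ENNReal.ofReal (((t : ℝ) ^ j)⁻¹ * (N : ℝ) ^ j) •
        (volume : Measure ℝ).restrict (Set.Icc a (a + ((N : ℝ) ^ j)⁻¹)) := by
  ext s hs
  rw [approxMeasure, withDensity_apply _ hs, lintegral_finsetSum _ fun a _ =>
    measurable_const.indicator measurableSet_Icc, Measure.finsetSum_apply]
  refine Finset.sum_congr rfl fun a _ => ?_
  rw [lintegral_indicator_const measurableSet_Icc, Measure.smul_apply, smul_eq_mul,
    Measure.restrict_apply hs, Measure.restrict_apply measurableSet_Icc, Set.inter_comm]

lemma integral_approxMeasure (hN : 0 < N) (j : ℕ) {g : ℝ → ℝ} (hg : Continuous g) :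
    ∫ x, g x ∂(approxMeasure N t D j) = ∑ a ∈ endpoints N D j,
      ((t : ℝ) ^ j)⁻¹ * ∫ v in (0 : ℝ)..1, g (a + ((N : ℝ) ^ j)⁻¹ * v) := by
  have hNj : (N : ℝ) ^ j ≠ 0 := by positivity
  rw [approxMeasure_eq_sum, integral_finsetSum_measure fun a _ =>
    Integrable.smul_measure hg.integrableOn_Icc ENNReal.ofReal_ne_top]
  refine Finset.sum_congr rfl fun a _ => ?_
  rw [integral_smul_measure, ENNReal.toReal_ofReal (by positivity), integral_Icc_eq_integral_Ioc,
    ← intervalIntegral.integral_of_le (le_add_of_nonneg_right (by positivity)),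
    intervalIntegral.integral_comp_add_mul _ (inv_ne_zero hNj)]
  simp [mul_assoc]

lemma continuous_integral_add_mul {g : ℝ → ℝ} (hg : Continuous g) :
    Continuous fun q : ℝ × ℝ => ∫ v in (0 : ℝ)..1, g (q.1 + q.2 * v) :=
  intervalIntegral.continuous_parametric_intervalIntegral_of_continuous' (by fun_prop) _ _

variable [NeZero t]

/-- The Cantor measure `μ = lim μ_j`, realised as the law of the end of a uniformly random
branch. -/
noncomputable def limitMeasure (N t : ℕ) [NeZero t] (D : ℕ → ℝ → Finset ℕ) : Measure ℝ :=
  (branchMeasure t).map fun ω => pathLimit N D ω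

section Mass

variable (hN : 0 < N) (hD : Admissible N t D)
include hN hD

lemma branchMeasure_real_path_eq {j : ℕ} {a : ℝ} (ha : a ∈ endpoints N D j) :
    (branchMeasure t).real {ω | path N D ω j = a} = ((t : ℝ) ^ j)⁻¹ := by
  obtain ⟨w, rfl⟩ := exists_path_eq hD ha
  simp_rw [path_eq_iff hN hD, ← Finset.mem_range]
  rw [measureReal_def, branchMeasure_cylinder]
  simp

lemma integral_comp_path (j : ℕ) {g : ℝ → ℝ} (hg : Continuous g) :
    ∫ ω, g (path N D ω j) ∂(branchMeasure t) =
      ∑ a ∈ endpoints N D j, ((t : ℝ) ^ j)⁻¹ * g a := by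
  set κ := (branchMeasure t).map fun ω => path N D ω j with hκ
  have : IsFiniteMeasure κ := by
    rw [hκ]
    infer_instance
  have hsupp : κ.restrict (endpoints N D j) = κ :=
    Measure.restrict_eq_self_of_ae_mem <|
      (ae_map_iff (p := (· ∈ (endpoints N D j : Set ℝ))) (measurable_path j).aemeasurable
        (Finset.measurableSet _)).2 (.of_forall fun ω => path_mem hD ω j)
  have hatom (a : ℝ) (ha : a ∈ endpoints N D j) : κ.real {a} = ((t : ℝ) ^ j)⁻¹ := by
    rw [map_measureReal_apply (measurable_path j) (measurableSet_singleton a)]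
    exact branchMeasure_real_path_eq hN hD ha
  rw [← integral_map (measurable_path j).aemeasurable hg.aestronglyMeasurable, ← hκ, ← hsupp,
    setIntegral_finset _ (hg.continuousOn.integrableOn_compact (Finset.finite_toSet _).isCompact)]
  exact Finset.sum_congr rfl fun a ha => by rw [hatom a ha, smul_eq_mul]

lemma ae_pathLimit_lt (ht : 1 < t) (j : ℕ) :
    ∀ᵐ ω ∂branchMeasure t, pathLimit N D ω < path N D ω j + ((N : ℝ) ^ j)⁻¹ := by
  have hne : ∀ᵐ ω ∂branchMeasure t, pathLimit N D ω ≠ path N D ω j + ((N : ℝ) ^ j)⁻¹ := by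
    refine measure_mono_null (fun ω hω => ?_) (branchMeasure_eventually_eq ht j ⊤)
    exact fun k hk => top_unique (forall_le_of_pathLimit_eq hN hD (not_not.1 hω) hk ⊤)
  exact hne.mono fun ω => (pathLimit_le hN hD ω j).lt_of_ne

lemma card_mul_le_limitMeasure_biUnion_Ico (ht : 1 < t) {j : ℕ} {S : Finset ℝ}
    (hS : S ⊆ endpoints N D j) :
    S.card * ((t : ℝ) ^ j)⁻¹ ≤
      (limitMeasure N t D).real (⋃ a ∈ S, Set.Ico a (a + ((N : ℝ) ^ j)⁻¹)) := by
  have hmass : (branchMeasure t).real (⋃ a ∈ S, {ω | path N D ω j = a}) =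
      S.card * ((t : ℝ) ^ j)⁻¹ := by
    rw [measureReal_biUnion_finset, Finset.sum_congr rfl fun a ha =>
      branchMeasure_real_path_eq hN hD (hS ha), Finset.sum_const, nsmul_eq_mul]
    · exact fun _ _ _ _ hab => Set.disjoint_left.2 fun ω ha hb => hab (ha.symm.trans hb)
    · exact fun a _ => measurable_path j (measurableSet_singleton a)
  rw [← hmass, limitMeasure, map_measureReal_apply (measurable_pathLimit hN hD)
    (S.measurableSet_biUnion fun _ _ => measurableSet_Ico)]
  refine ENNReal.toReal_mono (measure_ne_top _ _) (measure_mono_ae ?_)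
  filter_upwards [ae_pathLimit_lt hN hD ht j] with ω hlt hω
  obtain ⟨a, ha, rfl⟩ := Set.mem_iUnion₂.1 hω
  exact Set.mem_biUnion ha ⟨path_le_pathLimit hN hD ω j, hlt⟩

end Mass

lemma isWeakLimit_limitMeasure (hN1 : 1 < N) (hD : Admissible N t D) :
    IsWeakLimit N t D (limitMeasure N t D) := by
  have hN : 0 < N := one_pos.trans hN1
  have hlim : AEMeasurable (fun ω => pathLimit N D ω) (branchMeasure t) :=
    (measurable_pathLimit hN hD).aemeasurable
  refine ⟨Measure.isProbabilityMeasure_map hlim, fun g => ?_⟩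
  have hcont := continuous_integral_add_mul g.continuous
  have hcell (j : ℕ) : Continuous fun x => ∫ v in (0 : ℝ)..1, g (x + ((N : ℝ) ^ j)⁻¹ * v) :=
    hcont.comp (Continuous.prodMk_left _)
  have hwidth : Tendsto (fun j : ℕ => ((N : ℝ) ^ j)⁻¹) atTop (𝓝 0) :=
    (tendsto_pow_atTop_atTop_of_one_lt (by exact_mod_cast hN1)).inv_tendsto_atTop
  rw [limitMeasure, integral_map hlim g.continuous.aestronglyMeasurable]
  simp_rw [integral_approxMeasure hN _ g.continuous, ← integral_comp_path hN hD _ (hcell _)]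
  refine tendsto_integral_of_dominated_convergence (fun _ => ‖g‖)
    (fun j => ((hcell j).measurable.comp (measurable_path j)).aestronglyMeasurable)
    (integrable_const _) (fun j => .of_forall fun ω => ?_) (.of_forall fun ω => ?_)
  · simpa using intervalIntegral.norm_integral_le_of_norm_le_const (a := (0 : ℝ)) (b := 1)
      fun v _ => g.norm_coe_le_norm (path N D ω j + ((N : ℝ) ^ j)⁻¹ * v)
  · simpa [Function.comp_def] using (hcont.tendsto (pathLimit N D ω, 0)).comp
      ((tendsto_path hN hD ω).prodMk_nhds hwidth)

end LimitMeasure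

section LowerBound

variable {P : Finset ℕ}

lemma measurableSet_structuredSet (P : Finset ℕ) (l : ℕ) : MeasurableSet (structuredSet N P l) :=
  Finset.measurableSet_biUnion _ fun _ _ => measurableSet_Ico

lemma fourierMeas_structuredFun (P : Finset ℕ) (l : ℕ) (μ : Measure ℝ) :
    fourierMeas (structuredFun N P l) μ = fourierMeas 1 (μ.restrict (structuredSet N P l)) := by
  ext ξ
  rw [fourierMeas, fourierMeas, Fourier.fourierIntegral_def, Fourier.fourierIntegral_def,
    ← integral_indicator (measurableSet_structuredSet P l)]
  congr 1 with x
  by_cases hx : x ∈ structuredSet N P l <;> simp [structuredFun, hx]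

variable (hN : 0 < N) (hP : P.Nonempty) {r : ℕ} (hr : 0 < r) (l : ℕ) (μ : Measure ℝ)
  [IsFiniteMeasure μ]
include hN hP hr

lemma measure_structuredSet_pow_le :
    μ (structuredSet N P l) ^ (2 * r) ≤
      ENNReal.ofReal ((sumset r P).card ^ l * (r * ((N : ℝ) ^ l)⁻¹)) *
        ∫⁻ ξ, ‖fourierMeas (structuredFun N P l) μ ξ‖ₑ ^ (2 * r) := by
  have hw : 0 < r * ((N : ℝ) ^ l)⁻¹ := by positivity
  have hvol : volume (cells (structuredEndpoints N (sumset r P) l) (r * ((N : ℝ) ^ l)⁻¹)) ≤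
      ENNReal.ofReal ((sumset r P).card ^ l * (r * ((N : ℝ) ^ l)⁻¹)) := by
    rw [ENNReal.ofReal_mul (by positivity)]
    refine (volume_cells_le _ _).trans ?_
    gcongr
    rw [← Nat.cast_pow, ENNReal.ofReal_natCast]
    exact_mod_cast card_structuredEndpoints_le (sumset r P) l
  have hmain := measure_univ_pow_le (ν := μ.restrict (structuredSet N P l)) (isCompact_cells _ _)
    (volume_cells_ne_zero (structuredEndpoints_nonempty (sumset_nonempty hP) l) hw)
    (ae_restrict_mem (measurableSet_structuredSet P l)) fun _ => sum_mem_cells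
  rw [Measure.restrict_apply_univ, ← fourierMeas_structuredFun] at hmain
  exact hmain.trans (mul_le_mul_left hvol _)

lemma measure_structuredSet_rpow_le {p : ℝ} (hp : 0 < p) (hpr : p ≤ 2 * r) :
    μ (structuredSet N P l) ^ p ≤
      ENNReal.ofReal ((sumset r P).card ^ l * (r * ((N : ℝ) ^ l)⁻¹)) *
        ∫⁻ ξ, ‖fourierMeas (structuredFun N P l) μ ξ‖ₑ ^ p := by
  set m := μ (structuredSet N P l)
  obtain hm | hm := eq_or_ne m 0
  · simp [hm, ENNReal.zero_rpow_of_pos hp]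
  have hm_top : m ≠ ⊤ := measure_ne_top _ _
  have hpr' : p ≤ (2 * r : ℕ) := by exact_mod_cast hpr
  have hinterp := lintegral_enorm_fourierMeas_pow_le (f := 1)
    (ν := μ.restrict (structuredSet N P l)) (integrable_const 1) hp.le hpr'
  rw [← fourierMeas_structuredFun] at hinterp
  refine (ENNReal.mul_le_mul_iff_right (a := m ^ ((2 * r : ℕ) - p)) ?_
    (ENNReal.rpow_ne_top_of_nonneg (sub_nonneg.2 hpr') hm_top)).1 ?_
  · simp [ENNReal.rpow_eq_zero_iff, hm, hm_top]
  calc m ^ ((2 * r : ℕ) - p) * m ^ p = m ^ (2 * r) := by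
        rw [← ENNReal.rpow_add_of_nonneg _ _ (sub_nonneg.2 hpr') hp.le, sub_add_cancel,
          ENNReal.rpow_natCast]
    _ ≤ ENNReal.ofReal ((sumset r P).card ^ l * (r * ((N : ℝ) ^ l)⁻¹)) *
          (m ^ ((2 * r : ℕ) - p) * ∫⁻ ξ, ‖fourierMeas (structuredFun N P l) μ ξ‖ₑ ^ p) := by
        refine (measure_structuredSet_pow_le hN hP hr l μ).trans (mul_le_mul_right ?_ _)
        simpa [m] using hinterp
    _ = _ := mul_left_comm _ _ _

lemma measureReal_rpow_mul_le_eLpNorm_fourierMeas {p : ℝ} (hp : 0 < p) (hpr : p ≤ 2 * r) :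
    ENNReal.ofReal (μ.real (structuredSet N P l) ^ p *
        ((N : ℝ) ^ l / (r * (sumset r P).card ^ l))) ≤
      eLpNorm (fourierMeas (structuredFun N P l) μ) (ENNReal.ofReal p) volume ^ p := by
  have hK : (0 : ℝ) < (sumset r P).card := by exact_mod_cast (sumset_nonempty hP).card_pos
  have hvol : 0 < (sumset r P).card ^ l * (r * ((N : ℝ) ^ l)⁻¹) := by positivity
  have heq : μ.real (structuredSet N P l) ^ p * ((N : ℝ) ^ l / (r * (sumset r P).card ^ l)) =
      μ.real (structuredSet N P l) ^ p / ((sumset r P).card ^ l * (r * ((N : ℝ) ^ l)⁻¹)) := by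
    field_simp
  rw [eLpNorm_eq_lintegral_rpow_enorm_toReal (by simpa using hp) ENNReal.ofReal_ne_top,
    ENNReal.toReal_ofReal hp.le, ← ENNReal.rpow_mul, one_div_mul_cancel hp.ne', ENNReal.rpow_one,
    heq, ENNReal.ofReal_div_of_pos hvol, ← ENNReal.ofReal_rpow_of_nonneg measureReal_nonneg hp.le,
    ofReal_measureReal]
  exact ENNReal.div_le_of_le_mul' (measure_structuredSet_rpow_le hN hP hr l μ hp hpr)

end LowerBound

lemma mul_inv_div_rpow_le {N L K r p : ℝ} (hN : 0 ≤ N) (hL : 0 < L) (hr : 0 < r) (hK : 0 < K)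
    (hKL : K ≤ r * L) (l : ℕ) :
    N ^ l * (r ^ (l + 1))⁻¹ / (L ^ 2) ^ ((l : ℝ) * (p + 1) / 2) ≤
      ((L / L ^ 2) ^ l) ^ p * (N ^ l / (r * K ^ l)) := by
  have hpow : (L ^ 2) ^ ((l : ℝ) * (p + 1) / 2) = (L ^ l) ^ p * L ^ l := by
    rw [← Real.rpow_natCast_mul hL.le, ← Real.rpow_natCast_mul hL.le, ← Real.rpow_natCast L l,
      ← Real.rpow_add hL]
    congr 1
    push_cast
    ring
  have hratio : ((L / L ^ 2) ^ l) ^ p = ((L ^ l) ^ p)⁻¹ := by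
    rw [← Real.inv_rpow (by positivity), ← inv_pow]
    congr 2
    field_simp
  calc N ^ l * (r ^ (l + 1))⁻¹ / (L ^ 2) ^ ((l : ℝ) * (p + 1) / 2)
      = ((L ^ l) ^ p)⁻¹ * (N ^ l / (r * (r * L) ^ l)) := by
        rw [hpow]
        field_simp
        ring
    _ ≤ ((L / L ^ 2) ^ l) ^ p * (N ^ l / (r * K ^ l)) := by
        rw [hratio]
        gcongr

theorem exists_isWeakLimit_and_le_eLpNorm_fourierMeas {N t : ℕ} (ht : 1 < t)
    {D : ℕ → ℝ → Finset ℕ} (hD : Admissible N t D) :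
    ∃ μ : Measure ℝ, IsWeakLimit N t D μ ∧
      ∀ P ⊆ Finset.range N, P.Nonempty → ∀ l : ℕ, structuredEndpoints N P l ⊆ endpoints N D l →
        ∀ (r : ℕ) (p : ℝ), 0 < p → p ≤ 2 * r →
          ENNReal.ofReal ((((P.card : ℝ) / t) ^ l) ^ p *
              ((N : ℝ) ^ l / (r * (sumset r P).card ^ l))) ≤
            eLpNorm (fourierMeas (structuredFun N P l) μ) (ENNReal.ofReal p) volume ^ p := by
  have hN : 1 < N := by
    obtain ⟨hsub, hcard⟩ := hD 0 0 (Finset.mem_singleton_self 0)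
    exact ht.trans_le (by simpa [hcard] using Finset.card_le_card hsub)
  have : NeZero t := ⟨by lia⟩
  have hμ := isWeakLimit_limitMeasure hN hD
  have := hμ.1
  refine ⟨limitMeasure N t D, hμ, fun P hPN hP l hPD r p hp hpr => ?_⟩
  have hr : (0 : ℝ) < r := by linarith
  have hmass : ((P.card : ℝ) / t) ^ l ≤ (limitMeasure N t D).real (structuredSet N P l) := by
    have := card_mul_le_limitMeasure_biUnion_Ico (by lia) hD ht hPD
    rwa [card_structuredEndpoints (by lia) hPN, Nat.cast_pow, ← div_eq_mul_inv, ← div_pow] at this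
  refine le_trans (ENNReal.ofReal_le_ofReal ?_)
    (measureReal_rpow_mul_le_eLpNorm_fourierMeas (by lia) hP (mod_cast hr) l _ hp hpr)
  gcongr

end CantorRestriction

open CantorRestriction in
theorem proposition3p2_general {N t L : ℕ} (hL : 1 < L) (ht : t = L ^ 2)
    {D : ℕ → ℝ → Finset ℕ} (hD : Admissible N t D) :
    ∃ μ : Measure ℝ, IsWeakLimit N t D μ ∧
      ∀ P ⊆ Finset.range N, IsArithProg P L →
        ∀ l : ℕ, structuredEndpoints N P l ⊆ endpoints N D l →
          ∀ (r : ℕ) (p : ℝ), 0 < p → p ≤ 2 * r →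
            ENNReal.ofReal ((N : ℝ) ^ l * ((r : ℝ) ^ (l + 1))⁻¹ /
                (t : ℝ) ^ ((l : ℝ) * (p + 1) / 2)) ≤
              eLpNorm (fourierMeas (structuredFun N P l) μ) (ENNReal.ofReal p) volume ^ p := by
  have hL0 : 0 < L := one_pos.trans hL
  obtain ⟨μ, hμ, hbound⟩ :=
    exists_isWeakLimit_and_le_eLpNorm_fourierMeas (ht ▸ one_lt_pow₀ hL two_ne_zero) hD
  refine ⟨μ, hμ, fun P hPN hP l hPD r p hp hpr => ?_⟩
  have hr : (0 : ℝ) < r := by linarith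
  have hP0 : P.Nonempty := Finset.card_pos.1 (hP.card_eq.symm ▸ hL0)
  refine le_trans (ENNReal.ofReal_le_ofReal ?_) (hbound P hPN hP0 l hPD r p hp hpr)
  rw [hP.card_eq, ht, Nat.cast_pow]
  exact mul_inv_div_rpow_le N.cast_nonneg (mod_cast hL0) hr
    (mod_cast (sumset_nonempty hP0).card_pos) (mod_cast hP.card_sumset_le (mod_cast hr)) l

theorem proposition3p2 (r : ℕ) :
    ∃ C : ℝ, 0 < C ∧ ∃ nmin : ℕ,
      ∀ N₀ t₀ : ℕ, 1 < t₀ → t₀ < N₀ →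
      1 / (Real.log (t₀ : ℝ) / Real.log (N₀ : ℝ)) < (r : ℝ) →
      ∀ n₀ : ℕ, nmin ≤ n₀ →
      ∀ N t : ℕ, N = N₀ ^ (2 * n₀) → t = t₀ ^ (2 * n₀) →
      ∀ P : Finset ℕ, P ⊆ Finset.range N → CantorRestriction.IsArithProg P (t₀ ^ n₀) →
      ∀ D : ℕ → ℝ → Finset ℕ, CantorRestriction.Admissible N t D →
      (∀ j : ℕ, CantorRestriction.structuredEndpoints N P j ⊆
        CantorRestriction.endpoints N D j) →
      ∃ μ : Measure ℝ, CantorRestriction.IsWeakLimit N t D μ ∧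
        ∀ p : ℝ, 1 ≤ p → p ≤ 2 * (r : ℝ) →
          ∀ᶠ l : ℕ in atTop,
            ENNReal.ofReal (C * ((N : ℝ) ^ l * ((r : ℝ) ^ (l + 1))⁻¹ /
                (t : ℝ) ^ ((l : ℝ) * (p + 1) / 2))) ≤
              eLpNorm (CantorRestriction.fourierMeas
                (CantorRestriction.structuredFun N P l) μ) (ENNReal.ofReal p) volume ^ p := by
  refine ⟨1, one_pos, 1, fun N₀ t₀ ht₀ _ _ n₀ hn₀ N t _ ht P hPN hP D hD hPD => ?_⟩
  obtain ⟨μ, hμ, hbound⟩ := proposition3p2_general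
    (one_lt_pow₀ ht₀ (Nat.one_le_iff_ne_zero.1 hn₀)) (ht.trans (pow_mul' _ _ _)) hD
  refine ⟨μ, hμ, fun p hp hpr => .of_forall fun l => ?_⟩
  rw [one_mul]
  exact hbound P hPN hP l (hPD l) r p (one_pos.trans_le hp) hpr
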